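/- Let $\mathcal H$ be a finite-dimensional complex Hilbert space, $\Theta\subset\mathbb R$, and $\{\rho_\theta\}_{\theta\in\Theta}$ a family of density operators on $\mathcal H$. Fix an integer $m\ge 1$ and a measurable space $\Omega$. An $m$-adaptive estimator with $n$ blocks is a pair $\mathcal E_n=(M^n,T_n)$ of a POVM $M^n$ on $(\mathcal H^{\otimes m})^{\otimes n}$ with data set $\Omega^n$ of the form $$M^n(d\omega_1,\dots,d\omega_n)=M_1(d\omega_1)\otimes M_2(\omega_1;d\omega_2)\otimes\cdots\otimes M_n(\omega_1,\dots,\omega_{n-1};d\omega_n),$$ where each $M_l(\omega_1,\dots,\omega_{l-1};\cdot)$ is a POVM on $\mathcal H^{\otimes m}$ with data set $\Omega$, depending measurably on $(\omega_1,\dots,\omega_{l-1})$, and a measurable function $T_n:\Omega^n\to\mathbb R$. (The POVMs $M_l$ may be different for different $n$.) It uses $mn$ systems; when every system is in the state $\rho_\theta$, the data are distributed according to $\mathrm P^{M^n}_\theta(B)=\operatorname{Tr}\rho_\theta^{\otimes mn}M^n(B)$. For a sequence $\vec M=\{\mathcal E_n\}_n$ of $m$-adaptive estimators put $$\beta(\vec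 M,\theta,\epsilon)=\limsup_{n\to\infty}\frac{-1}{mn}\log \mathrm P^{M^n}_\theta\{|T_n-\theta|>\epsilon\},\qquad \alpha(\vec M,\theta)=\limsup_{\epsilon\to+0}\frac{\beta(\vec M,\theta,\epsilon)}{\epsilon^2},$$ both in $[0,\infty]$, with $-\log 0=\infty$. For a POVM $M$ on $\mathcal H^{\otimes m}$, with any data set, let $D^M(\theta\|\theta_1)\in[0,\infty]$ be the relative entropy of the distribution $\operatorname{Tr}\rho_\theta^{\otimes m}M(\cdot)$ with respect to $\operatorname{Tr}\rho_{\theta_1}^{\otimes m}M(\cdot)$. Suppose that $\vec M$ is weakly consistent: $\lim_{n\to\infty}\mathrm P^{M^n}_\theta\{|T_n-\theta|>\epsilon\}=0$ for all $\theta\in\Theta$ and all $\epsilon>0$. Let $\theta_1\in\Theta$. (1) For every $\epsilon>0$, $$\beta(\vec M,\theta_1,\epsilon)\le\inf_{\theta\in\Theta,\ |\theta-\theta_1|>\epsilon}\ \ \sup_{M:\ \text{POVM on }\mathcal H^{\otimes m}}\frac1m D^M(\theta\|\theta_1)$$ (with $\inf\emptyset=\infty$). (2) Suppose in addition that $\Theta$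 contains $(\theta_1,\theta_1+r)$ or $(\theta_1-r,\theta_1)$ for some $r>0$, that $\theta\mapsto\rho_\theta$ is differentiable at $\theta_1$ (as a map on $\Theta$) with derivative $\rho'_{\theta_1}$, and that the support of $\rho_\theta$ is contained in the support of $\rho_{\theta_1}$ for all $\theta\in\Theta$ close to $\theta_1$ (for example, $\rho_{\theta_1}>0$). Then $$\alpha(\vec M,\theta_1)\le\frac{J_{\theta_1}}2 ,$$ where $J_{\theta_1}=\operatorname{Tr}L^2\rho_{\theta_1}$ is the SLD Fisher information, $L$ being any self-adjoint operator with $\tfrac12(L\rho_{\theta_1}+\rho_{\theta_1}L)=\rho'_{\theta_1}$. -/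

import Mathlib

open MeasureTheory ProbabilityTheory Filter Topology
open scoped ENNReal Matrix ComplexOrder

universe u

namespace QuantumEstimation

/-- Density matrices on the finite-dimensional Hilbert space with orthonormal basis `ι`. -/
def State (ι : Type*) [Fintype ι] : Type _ :=
  {ρ : Matrix ι ι ℂ // ρ.PosSemidef ∧ ρ.trace = 1}

/-- The tensor product of `n` operators on the space with basis `ι`, as an operator on the
`n`-fold tensor power, whose product basis is `Fin n → ι`. -/
def tensorMatrix {ι : Type*} {n : ℕ} (A : Fin n → Matrix ι ι ℂ) :
    Matrix (Fin n → ι) (Fin n → ι) ℂ :=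
  Matrix.of fun x y => ∏ l, A l (x l) (y l)

theorem tensorMatrix_conjTranspose {ι : Type*} {n : ℕ} (A : Fin n → Matrix ι ι ℂ) :
    (tensorMatrix A)ᴴ = tensorMatrix fun l => (A l)ᴴ := by
  ext x y
  simp [tensorMatrix, Matrix.conjTranspose_apply]

section
variable {ι : Type*} [Fintype ι] {n : ℕ}

theorem tensorMatrix_mul (A B : Fin n → Matrix ι ι ℂ) :
    tensorMatrix A * tensorMatrix B = tensorMatrix fun l => A l * B l := by
  ext x y
  simp only [tensorMatrix, Matrix.mul_apply, Matrix.of_apply, ← Finset.prod_mul_distrib]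
  classical
  rw [Finset.prod_univ_sum]
  simp

theorem trace_tensorMatrix (A : Fin n → Matrix ι ι ℂ) :
    (tensorMatrix A).trace = ∏ l, (A l).trace := by
  simp only [Matrix.trace, tensorMatrix, Matrix.diag_apply, Matrix.of_apply]
  classical
  rw [Finset.prod_univ_sum]
  simp

theorem tensorMatrix_posSemidef {A : Fin n → Matrix ι ι ℂ} (hA : ∀ l, (A l).PosSemidef) :
    (tensorMatrix A).PosSemidef := by
  classical
  have h : ∀ l, ∃ B : Matrix ι ι ℂ, A l = Bᴴ * B := fun l => by
    open scoped MatrixOrder in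
    obtain ⟨B, hB⟩ := CStarAlgebra.nonneg_iff_eq_star_mul_self.mp (hA l).nonneg
    exact ⟨B, hB⟩
  choose B hB using h
  have : tensorMatrix A = (tensorMatrix B)ᴴ * tensorMatrix B := by
    rw [tensorMatrix_conjTranspose, tensorMatrix_mul]
    congr 1
    funext l
    exact hB l
  rw [this]
  exact Matrix.posSemidef_conjTranspose_mul_self _

/-- The product state `σ₁ ⊗ ⋯ ⊗ σₙ`. -/
def State.tensor (σ : Fin n → State ι) : State (Fin n → ι) :=
  ⟨tensorMatrix fun l => (σ l).1, tensorMatrix_posSemidef fun l => (σ l).2.1, by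
    rw [trace_tensorMatrix]
    exact Finset.prod_eq_one fun l _ => (σ l).2.2⟩

/-- The state `ρ^{⊗ n}`. -/
def State.tensorPow (ρ : State ι) (n : ℕ) : State (Fin n → ι) :=
  State.tensor fun _ : Fin n => ρ

end

/-- A POVM with data set `Ω` on the Hilbert space with orthonormal basis `ι`. Only the values of
`toFun` on measurable sets are meaningful. -/
structure POVM (Ω : Type*) [MeasurableSpace Ω] (ι : Type*) [Fintype ι] [DecidableEq ι] where
  toFun : Set Ω → Matrix ι ι ℂ
  posSemidef : ∀ B, MeasurableSet B → (toFun B).PosSemidef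
  empty : toFun ∅ = 0
  univ : toFun Set.univ = 1
  iUnion : ∀ B : ℕ → Set Ω, (∀ i, MeasurableSet (B i)) → Pairwise (fun i j => Disjoint (B i) (B j)) →
    HasSum (fun i => toFun (B i)) (toFun (⋃ i, B i))

section
variable {Ω : Type*} [MeasurableSpace Ω] {ι : Type*} [Fintype ι] [DecidableEq ι]

theorem trace_mul_re_nonneg {A B : Matrix ι ι ℂ} (hA : A.PosSemidef) (hB : B.PosSemidef) :
    0 ≤ (A * B).trace.re := by
  open scoped MatrixOrder in
  obtain ⟨C, hC⟩ := CStarAlgebra.nonneg_iff_eq_star_mul_self.mp hA.nonneg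
  have h : (A * B).trace = (C * B * Cᴴ).trace := by
    rw [hC, Matrix.star_eq_conjTranspose, Matrix.mul_assoc, Matrix.trace_mul_comm, Matrix.mul_assoc,
      ← Matrix.mul_assoc]
  rw [h]
  exact (Complex.nonneg_iff.mp (hB.mul_mul_conjTranspose_same C).trace_nonneg).1

/-- The distribution `B ↦ Tr ρ M(B)` of the data of the measurement `M` in the state `ρ`. -/
noncomputable def POVM.law (M : POVM Ω ι) (ρ : State ι) : Measure Ω :=
  Measure.ofMeasurable (fun B _ => ENNReal.ofReal (ρ.1 * M.toFun B).trace.re)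
    (by simp [M.empty])
    (by
      intro B hB hd
      have h := M.iUnion B hB hd
      have hc : Continuous fun A : Matrix ι ι ℂ => (ρ.1 * A).trace.re := by fun_prop
      have h2 : HasSum (fun i => (ρ.1 * M.toFun (B i)).trace.re)
          (ρ.1 * M.toFun (⋃ i, B i)).trace.re := by
        let f : Matrix ι ι ℂ →+ ℝ :=
          { toFun := fun A => (ρ.1 * A).trace.re
            map_zero' := by simp
            map_add' := fun A A' => by simp [Matrix.mul_add] }
        exact h.map f hc
      rw [← h2.tsum_eq, ENNReal.ofReal_tsum_of_nonneg
        (fun i => trace_mul_re_nonneg ρ.2.1 (M.posSemidef _ (hB i))) h2.summable])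

theorem POVM.law_apply (M : POVM Ω ι) (ρ : State ι) {B : Set Ω} (hB : MeasurableSet B) :
    M.law ρ B = ENNReal.ofReal (ρ.1 * M.toFun B).trace.re :=
  Measure.ofMeasurable_apply B hB

instance (M : POVM Ω ι) (ρ : State ι) : IsProbabilityMeasure (M.law ρ) :=
  ⟨by rw [M.law_apply ρ MeasurableSet.univ, M.univ]; simp [ρ.2.2]⟩

end

/-- A measurable rule that chooses a POVM from previous data `x`. -/
structure POVMRule (X : Type*) [MeasurableSpace X] (Ω : Type*) [MeasurableSpace Ω]
    (ι : Type*) [Fintype ι] [DecidableEq ι] where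
  povm : X → POVM Ω ι
  measurable : ∀ B, MeasurableSet B → ∀ i j, Measurable fun x => (povm x).toFun B i j

section
variable {X : Type*} [MeasurableSpace X] {Ω : Type*} [MeasurableSpace Ω]
  {ι : Type*} [Fintype ι] [DecidableEq ι]

/-- The transition kernel `x ↦ Tr σ M(x; ·)`. -/
noncomputable def POVMRule.kernel (K : POVMRule X Ω ι) (σ : State ι) : Kernel X Ω where
  toFun x := (K.povm x).law σ
  measurable' := by
    refine Measure.measurable_of_measurable_coe _ fun B hB => ?_
    simp only [POVM.law_apply _ _ hB]
    refine ENNReal.measurable_ofReal.comp (Complex.measurable_re.comp ?_)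
    simp only [Matrix.trace, Matrix.diag_apply, Matrix.mul_apply]
    exact Finset.measurable_sum _ fun i _ => Finset.measurable_sum _ fun j _ =>
      (K.measurable B hB j i).const_mul _

instance (K : POVMRule X Ω ι) (σ : State ι) : IsMarkovKernel (K.kernel σ) :=
  ⟨fun x => inferInstanceAs (IsProbabilityMeasure ((K.povm x).law σ))⟩

/-- The distribution of the data `(ω₁, …, ωₙ)` when the `l`-th subsystem is in the state `σ l` and
is measured by the POVM which the rule `K l` chooses from the data `(ω₁, …, ω_{l-1})`
(subsystems are numbered from `0` in the code). -/
noncomputable def sequentialLaw (K : (l : ℕ) → POVMRule (Fin l → Ω) Ω ι) (σ : ℕ → State ι) :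
    (n : ℕ) → Measure (Fin n → Ω)
  | 0 => Measure.dirac Fin.elim0
  | n + 1 => ((sequentialLaw K σ n) ⊗ₘ ((K n).kernel (σ n))).map
      fun p => Fin.snoc (α := fun _ => Ω) p.1 p.2

theorem measurable_snoc (n : ℕ) :
    Measurable fun p : (Fin n → Ω) × Ω => Fin.snoc (α := fun _ => Ω) p.1 p.2 := by
  refine measurable_pi_lambda _ fun i => ?_
  refine Fin.lastCases ?_ (fun j => ?_) i
  · simpa using measurable_snd
  · simpa [Function.comp_def] using
      (measurable_pi_apply (X := fun _ : Fin n => Ω) j).comp (measurable_fst (β := Ω))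

instance (K : (l : ℕ) → POVMRule (Fin l → Ω) Ω ι) (σ : ℕ → State ι) (n : ℕ) :
    IsProbabilityMeasure (sequentialLaw K σ n) := by
  induction n with
  | zero => rw [sequentialLaw]; infer_instance
  | succ n ih =>
    rw [sequentialLaw]
    exact Measure.isProbabilityMeasure_map (measurable_snoc n).aemeasurable

/-- `M` is the POVM `M₁(ω₁) ⊗ M₂(ω₁; ω₂) ⊗ ⋯ ⊗ Mₙ(ω₁, …, ω_{n-1}; ωₙ)` on the `n`-fold tensor
power. For general data sets this is an identity of operator-valued measures; it is tested here
against product states, which span all operators and hence determine `M`. For countable discrete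
data sets it says that `M {ω} = M₁ {ω₁} ⊗ M₂(ω₁) {ω₂} ⊗ ⋯`. -/
def IsAdaptiveProduct {n : ℕ} (M : POVM (Fin n → Ω) (Fin n → ι))
    (K : (l : ℕ) → POVMRule (Fin l → Ω) Ω ι) : Prop :=
  ∀ σ : ℕ → State ι, M.law (State.tensor fun l : Fin n => σ l) = sequentialLaw K σ n

end

/-- An `m`-adaptive estimator that uses `n` blocks of `m` systems each. The Hilbert space of one
system has basis `d`, that of a block has basis `Fin m → d`. -/
structure AdaptiveEstimator (Ω : Type*) [MeasurableSpace Ω] (d : Type*) [Fintype d] [DecidableEq d]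
    (m n : ℕ) where
  povm : POVM (Fin n → Ω) (Fin n → Fin m → d)
  rule : (l : ℕ) → POVMRule (Fin l → Ω) Ω (Fin m → d)
  isAdaptiveProduct : IsAdaptiveProduct povm rule
  estimate : (Fin n → Ω) → ℝ
  measurable_estimate : Measurable estimate

section
variable {Ω : Type*} [MeasurableSpace Ω] {d : Type*} [Fintype d] [DecidableEq d] {m : ℕ}

/-- The probability of `|θ̂ - θ| > ε` when all `m * n` systems are in the state `ρ`. -/
noncomputable def AdaptiveEstimator.tailProb {n : ℕ} (E : AdaptiveEstimator Ω d m n)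
    (ρ : State d) (θ ε : ℝ) : ℝ≥0∞ :=
  E.povm.law ((ρ.tensorPow m).tensorPow n) {ω | ε < |E.estimate ω - θ|}

/-- Weak consistency of a sequence of estimators for the family `ρ θ`, `θ ∈ Θ`. -/
def WeaklyConsistent (Θ : Set ℝ) (ρ : ℝ → State d) (E : (n : ℕ) → AdaptiveEstimator Ω d m n) :
    Prop :=
  ∀ θ ∈ Θ, ∀ ε : ℝ, 0 < ε → Tendsto (fun n => (E n).tailProb (ρ θ) θ ε) atTop (𝓝 0)

/-- The exponent of the tail probability per system; the `n`-th estimator uses `m * n` systems. -/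
noncomputable def bahadurBeta (ρ : ℝ → State d) (E : (n : ℕ) → AdaptiveEstimator Ω d m n) (θ ε : ℝ) :
    EReal :=
  limsup (fun n : ℕ => -(ENNReal.log ((E n).tailProb (ρ θ) θ ε)) / ((m * n : ℕ) : EReal)) atTop

/-- The limit superior of `β(ε) / ε²` as `ε → +0`. -/
noncomputable def bahadurAlpha (ρ : ℝ → State d) (E : (n : ℕ) → AdaptiveEstimator Ω d m n) (θ : ℝ) :
    EReal :=
  limsup (fun ε : ℝ => bahadurBeta ρ E θ ε / ((ε ^ 2 : ℝ) : EReal)) (𝓝[>] 0)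

end

section
variable {ι : Type*} [Fintype ι] [DecidableEq ι]

/-- The supremum over all POVMs `M`, with arbitrary data sets, of the relative entropy of the
distributions of the data of `M` in the states `ρ` and `σ`. -/
noncomputable def maxDivergence (ρ σ : State ι) : ℝ≥0∞ :=
  ⨆ (Ω : Type u) (_ : MeasurableSpace Ω) (M : POVM Ω ι),
    InformationTheory.klDiv (M.law ρ) (M.law σ)

/-- `L` is a symmetric logarithmic derivative at a state `ρ` of a family with derivative `ρ'`. -/
def IsSLD (ρ ρ' L : Matrix ι ι ℂ) : Prop :=
  L.IsHermitian ∧ (1 / 2 : ℂ) • (L * ρ + ρ * L) = ρ'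

/-- The SLD Fisher information `Tr L² ρ`. -/
noncomputable def sldFisher (ρ L : Matrix ι ι ℂ) : ℝ := (L * L * ρ).trace.re

end

end QuantumEstimation

open QuantumEstimation

/-! Part (1) is a Stein-type converse. Adaptivity gives nothing beyond the best measurement on one
block: conditionally on the past, each block contributes at most the largest divergence `C` between
the two block states. The Donsker–Varadhan inequality makes this a chain rule needing no divergence
of the joint law: the log-exponential average over the last outcome is again a bounded function of
the earlier outcomes, so the inequality iterates (`integral_sequentialLaw_le`). Test functions `t *
1_A` then bound the exponent of an event under `τ` by about `n * C / P(A)`, with `P(A)` its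
probability under `σ`. For `|θ - θ₁| > ε`, consistency at `θ` drives the probability of the tail
event around `θ₁` to one.

Part (2) needs the maximal divergence to be at most `m * J / 2 * (θ - θ₁)²` up to a factor tending
to one, uniformly over all POVMs with arbitrary data sets. Positivity of `(h L - t) σ (h L - t)` for
every `t` bounds the squared deviation of the likelihood ratio from one by the density of the law of
a fixed state `τ` proportional to `L σ L + κ σ`. That law has total mass one whatever the POVM,
which yields the uniform estimate `eventually_maxDivergence_le`. Additivity of the SLD information
gives the factor `m`, cancelled by the normalization per system; finally `θ` approaches `θ₁` at
distance slightly larger than `ε`. -/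

namespace QuantumEstimation

/-! ### Donsker–Varadhan inequality and adaptive measurements -/

section Variational

open InformationTheory

theorem integrable_of_measurable_of_bounded {X : Type*} [MeasurableSpace X] {μ : Measure X}
    [IsFiniteMeasure μ] {f : X → ℝ} (hf : Measurable f) {c : ℝ} (hc : ∀ x, |f x| ≤ c) :
    Integrable f μ :=
  Integrable.of_bound hf.aestronglyMeasurable c (Eventually.of_forall hc)

theorem integrable_exp_of_bounded {X : Type*} [MeasurableSpace X] {μ : Measure X}
    [IsFiniteMeasure μ] {f : X → ℝ} (hf : Measurable f) {c : ℝ} (hc : ∀ x, |f x| ≤ c) :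
    Integrable (fun x => Real.exp (f x)) μ := by
  refine integrable_of_measurable_of_bounded hf.exp (c := Real.exp c) fun x => ?_
  rw [abs_of_pos (Real.exp_pos _)]
  exact Real.exp_le_exp.mpr ((le_abs_self _).trans (hc x))

/-- The Donsker–Varadhan inequality for bounded functions. -/
theorem integral_le_toReal_klDiv_add_log {X : Type*} [MeasurableSpace X] {μ ν : Measure X}
    [IsProbabilityMeasure μ] [IsProbabilityMeasure ν] (h : klDiv μ ν ≠ ∞) {f : X → ℝ}
    (hf : Measurable f) {c : ℝ} (hc : ∀ x, |f x| ≤ c) :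
    ∫ x, f x ∂μ ≤ (klDiv μ ν).toReal + Real.log (∫ x, Real.exp (f x) ∂ν) := by
  obtain ⟨hac, hint⟩ := klDiv_ne_top_iff.mp h
  have hfμ : Integrable f μ := integrable_of_measurable_of_bounded hf hc
  have hfν : Integrable (fun x => Real.exp (f x)) ν := integrable_exp_of_bounded hf hc
  have := isProbabilityMeasure_tilted hfν
  -- This is nonnegativity of the divergence of `μ` from the measure `ν` tilted by `f`.
  have h0 := integral_llr_add_sub_measure_univ_nonneg
    (hac.trans (absolutelyContinuous_tilted hfν)) (integrable_llr_tilted_right hac hfμ hint hfν)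
  rw [integral_llr_tilted_right hac hfμ hfν hint] at h0
  rw [toReal_klDiv_of_measure_eq hac (by simp)]
  simp only [probReal_univ] at h0
  linarith

/-- Exponential averages of functions bounded by `c` in absolute value are bounded by `c`. -/
theorem abs_log_integral_exp_le {X : Type*} [MeasurableSpace X] {ν : Measure X}
    [IsProbabilityMeasure ν] {f : X → ℝ} (hf : Measurable f) {c : ℝ} (hc : ∀ x, |f x| ≤ c) :
    0 < ∫ x, Real.exp (f x) ∂ν ∧ |Real.log (∫ x, Real.exp (f x) ∂ν)| ≤ c := by
  have hi : Integrable (fun x => Real.exp (f x)) ν := integrable_exp_of_bounded hf hc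
  have h1 : Real.exp (-c) ≤ ∫ x, Real.exp (f x) ∂ν := by
    have := integral_mono (integrable_const (Real.exp (-c))) hi
      fun x => Real.exp_le_exp.mpr (abs_le.mp (hc x)).1
    simpa using this
  have h2 : ∫ x, Real.exp (f x) ∂ν ≤ Real.exp c := by
    have := integral_mono hi (integrable_const (Real.exp c))
      fun x => Real.exp_le_exp.mpr (abs_le.mp (hc x)).2
    simpa using this
  have h0 := (Real.exp_pos _).trans_le h1
  exact ⟨h0, abs_le.mpr ⟨(Real.le_log_iff_exp_le h0).mpr h1, (Real.log_le_iff_le_exp h0).mpr h2⟩⟩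

variable {Ω : Type*} [MeasurableSpace Ω] {ι : Type*} [Fintype ι] [DecidableEq ι]

theorem integral_sequentialLaw_succ (K : (l : ℕ) → POVMRule (Fin l → Ω) Ω ι) (σ : ℕ → State ι)
    (n : ℕ) {f : (Fin (n + 1) → Ω) → ℝ} (hf : Measurable f) {c : ℝ} (hc : ∀ x, |f x| ≤ c) :
    ∫ x, f x ∂(sequentialLaw K σ (n + 1)) =
      ∫ x, ∫ y, f (Fin.snoc (α := fun _ => Ω) x y) ∂(((K n).povm x).law (σ n))
        ∂(sequentialLaw K σ n) := by
  rw [sequentialLaw, integral_map (measurable_snoc n).aemeasurable hf.aestronglyMeasurable,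
    Measure.integral_compProd]
  · rfl
  · exact integrable_of_measurable_of_bounded (hf.comp (measurable_snoc n)) fun p => hc _

/-- If no single measurement distinguishes `σ` from `τ` by more than `C`, then adaptive measurements
of `n` subsystems satisfy the variational form of the bound `n * C`. -/
theorem integral_sequentialLaw_le (K : (l : ℕ) → POVMRule (Fin l → Ω) Ω ι) (σ τ : State ι) {C : ℝ}
    (hfin : ∀ M : POVM Ω ι, klDiv (M.law σ) (M.law τ) ≠ ∞)
    (hC : ∀ M : POVM Ω ι, (klDiv (M.law σ) (M.law τ)).toReal ≤ C) (n : ℕ)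
    {f : (Fin n → Ω) → ℝ} (hf : Measurable f) {c : ℝ} (hc : ∀ x, |f x| ≤ c) :
    ∫ x, f x ∂(sequentialLaw K (fun _ => σ) n) ≤
      n * C + Real.log (∫ x, Real.exp (f x) ∂(sequentialLaw K (fun _ => τ) n)) := by
  induction n with
  | zero =>
    have : f = fun _ => f Fin.elim0 := funext fun x => congrArg f (Subsingleton.elim _ _)
    rw [this]
    simp
  | succ n ih =>
    have hsec : ∀ x : Fin n → Ω, Measurable fun y => f (Fin.snoc (α := fun _ => Ω) x y) := fun x =>
      hf.comp ((measurable_snoc n).comp measurable_prodMk_left)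
    have hexp : ∀ x, |Real.exp (f x)| ≤ Real.exp c := fun x => by
      rw [abs_of_pos (Real.exp_pos _)]
      exact Real.exp_le_exp.mpr ((le_abs_self _).trans (hc x))
    rw [integral_sequentialLaw_succ K _ n hf hc, integral_sequentialLaw_succ K _ n hf.exp hexp]
    have hmeas : ∀ (ρ : State ι) (g : (Fin (n + 1) → Ω) → ℝ), Measurable g →
        Measurable fun x : Fin n → Ω =>
          ∫ y, g (Fin.snoc (α := fun _ => Ω) x y) ∂(((K n).povm x).law ρ) := fun ρ g hg =>
      (StronglyMeasurable.integral_kernel_prod_right' (κ := (K n).kernel ρ)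
        (hg.comp (measurable_snoc n)).stronglyMeasurable).measurable
    -- The last outcome is integrated out into `g`, which keeps the bound `c` and serves as test
    -- function for the induction hypothesis; averaging `exp ∘ g` restores the full exponential
    -- integral under `τ`.
    set g : (Fin n → Ω) → ℝ := fun x =>
      Real.log (∫ y, Real.exp (f (Fin.snoc (α := fun _ => Ω) x y)) ∂(((K n).povm x).law τ)) with hg
    have hgm : Measurable g := (hmeas τ _ hf.exp).log
    have hgb : ∀ x, |g x| ≤ c := fun x => (abs_log_integral_exp_le (hsec x) fun y => hc _).2
    have hgexp : ∀ x, Real.exp (g x) =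
        ∫ y, Real.exp (f (Fin.snoc (α := fun _ => Ω) x y)) ∂(((K n).povm x).law τ) := fun x =>
      Real.exp_log (abs_log_integral_exp_le (hsec x) fun y => hc _).1
    have hstep : ∀ x, ∫ y, f (Fin.snoc (α := fun _ => Ω) x y) ∂(((K n).povm x).law σ) ≤
        C + g x := fun x =>
      (integral_le_toReal_klDiv_add_log (hfin _) (hsec x) fun y => hc _).trans
        (by gcongr; exact hC _)
    have hgi : Integrable g (sequentialLaw K (fun _ => σ) n) :=
      integrable_of_measurable_of_bounded hgm hgb
    calc
      _ ≤ ∫ x, (C + g x) ∂(sequentialLaw K (fun _ => σ) n) := by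
        refine integral_mono (integrable_of_measurable_of_bounded (hmeas σ f hf) (c := c) fun x => ?_)
          ((integrable_const C).add hgi) hstep
        have := norm_integral_le_of_norm_le_const (μ := ((K n).povm x).law σ)
          (f := fun y => f (Fin.snoc (α := fun _ => Ω) x y)) (C := c)
          (Eventually.of_forall fun y => hc _)
        simpa using this
      _ = C + ∫ x, g x ∂(sequentialLaw K (fun _ => σ) n) := by
        rw [integral_add (integrable_const C) hgi]
        simp
      _ ≤ C + (n * C + Real.log (∫ x, Real.exp (g x) ∂(sequentialLaw K (fun _ => τ) n))) := by
        gcongr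
        exact ih hgm hgb
      _ = _ := by
        simp only [hgexp]
        push_cast
        ring

/-- The error exponent of an event under `τ` is bounded by the divergence from `σ` divided by the
probability of the event under `σ`. -/
theorem neg_log_sequentialLaw_mul_le (K : (l : ℕ) → POVMRule (Fin l → Ω) Ω ι) (σ τ : State ι)
    {C : ℝ} (hfin : ∀ M : POVM Ω ι, klDiv (M.law σ) (M.law τ) ≠ ∞)
    (hC : ∀ M : POVM Ω ι, (klDiv (M.law σ) (M.law τ)).toReal ≤ C) (n : ℕ)
    {A : Set (Fin n → Ω)} (hA : MeasurableSet A)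
    (hpos : 0 < (sequentialLaw K (fun _ => σ) n).real A) :
    0 < (sequentialLaw K (fun _ => τ) n).real A ∧
      -Real.log ((sequentialLaw K (fun _ => τ) n).real A) *
        (sequentialLaw K (fun _ => σ) n).real A ≤ n * C + Real.log 2 := by
  set P := (sequentialLaw K (fun _ => σ) n).real A
  set Q := (sequentialLaw K (fun _ => τ) n).real A with hQ
  have key : ∀ t : ℝ, t * P ≤ n * C + Real.log (1 + Real.exp t * Q) := fun t => by
    have hm : Measurable (A.indicator fun _ => t) := measurable_const.indicator hA
    have h := integral_sequentialLaw_le K σ τ hfin hC n hm (c := |t|) fun x => by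
      by_cases hx : x ∈ A <;> simp [hx]
    have hpt : ∀ x, Real.exp (A.indicator (fun _ => t) x) ≤
        1 + A.indicator (fun _ => Real.exp t) x := fun x => by
      by_cases hx : x ∈ A <;> simp [hx]
    have hi : Integrable (A.indicator fun _ => Real.exp t) (sequentialLaw K (fun _ => τ) n) :=
      (integrable_const _).indicator hA
    have h2 : ∫ x, Real.exp (A.indicator (fun _ => t) x) ∂(sequentialLaw K (fun _ => τ) n) ≤
        1 + Real.exp t * Q := by
      refine (integral_mono (integrable_exp_of_bounded hm (c := |t|) fun x => ?_)
        ((integrable_const 1).add hi) hpt).trans_eq ?_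
      · by_cases hx : x ∈ A <;> simp [hx]
      · simp only [Pi.add_apply]
        rw [integral_add (integrable_const 1) hi, integral_indicator_const _ hA]
        simp [hQ, mul_comm]
    have h3 : 0 < ∫ x, Real.exp (A.indicator (fun _ => t) x) ∂(sequentialLaw K (fun _ => τ) n) :=
      (abs_log_integral_exp_le hm (c := |t|) fun x => by by_cases hx : x ∈ A <;> simp [hx]).1
    rw [integral_indicator_const _ hA, smul_eq_mul, mul_comm] at h
    exact h.trans (by gcongr)
  have hQ0 : 0 < Q := by
    rcases measureReal_nonneg.lt_or_eq with h | h
    · exact h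
    · exfalso
      -- If `Q = 0`, the logarithm vanishes for every `t`, and this `t` turns the inequality into `n
      -- * C + 1 ≤ n * C`.
      have := key ((n * C + 1) / P)
      rw [div_mul_cancel₀ _ hpos.ne', hQ, ← h] at this
      simp at this
      linarith
  -- The choice is `t = -log Q`, so that `exp t * Q = 1` and the last term is `log 2`.
  refine ⟨hQ0, (key _).trans_eq ?_⟩
  rw [Real.exp_neg, Real.exp_log hQ0, inv_mul_cancel₀ hQ0.ne']
  norm_num

end Variational

/-! ### Consistency and the bound on the tail exponent -/

section Consistency

open InformationTheory

variable {Ω : Type u} [MeasurableSpace Ω] {ι : Type*} [Fintype ι] [DecidableEq ι]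

theorem klDiv_law_le_maxDivergence (M : POVM Ω ι) (ρ σ : State ι) :
    klDiv (M.law ρ) (M.law σ) ≤ maxDivergence.{u} ρ σ :=
  le_iSup_of_le Ω (le_iSup₂_of_le _ M le_rfl)

variable {d : Type*} [Fintype d] [DecidableEq d] {m : ℕ}

theorem AdaptiveEstimator.povm_law_tensorPow {n : ℕ} (E : AdaptiveEstimator Ω d m n)
    (ρ : State d) :
    E.povm.law ((ρ.tensorPow m).tensorPow n) =
      sequentialLaw E.rule (fun _ => ρ.tensorPow m) n :=
  E.isAdaptiveProduct fun _ => ρ.tensorPow m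

theorem AdaptiveEstimator.measurableSet_tail {n : ℕ} (E : AdaptiveEstimator Ω d m n) (θ ε : ℝ) :
    MeasurableSet {ω | ε < |E.estimate ω - θ|} :=
  measurableSet_lt measurable_const (E.measurable_estimate.sub_const θ).abs

/-- A weakly consistent sequence recognizes a parameter at distance larger than `ε` from `θ₁`. -/
theorem WeaklyConsistent.tendsto_tail {Θ : Set ℝ} {ρ : ℝ → State d}
    {E : (n : ℕ) → AdaptiveEstimator Ω d m n} (hE : WeaklyConsistent Θ ρ E) {θ θ₁ ε : ℝ}
    (hθ : θ ∈ Θ) (hε : ε < |θ - θ₁|) :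
    Tendsto (fun n => (sequentialLaw (E n).rule (fun _ => (ρ θ).tensorPow m) n).real
      {ω | ε < |(E n).estimate ω - θ₁|}) atTop (𝓝 1) := by
  -- Half of the gap `|θ - θ₁| - ε` suffices: an estimate that close to `θ` is still farther than
  -- `ε` from `θ₁`.
  have h := (ENNReal.tendsto_toReal ENNReal.zero_ne_top).comp
    (hE θ hθ ((|θ - θ₁| - ε) / 2) (by linarith))
  refine tendsto_of_tendsto_of_tendsto_of_le_of_le
    (g := fun n => 1 - ((E n).tailProb (ρ θ) θ ((|θ - θ₁| - ε) / 2)).toReal)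
    ?_ tendsto_const_nhds (fun n => ?_) fun n => measureReal_le_one
  · simpa using h.const_sub 1
  · have hm := (E n).measurableSet_tail θ ((|θ - θ₁| - ε) / 2)
    dsimp only
    rw [AdaptiveEstimator.tailProb, AdaptiveEstimator.povm_law_tensorPow, ← measureReal_def,
      ← probReal_compl_eq_one_sub hm]
    refine measureReal_mono fun ω hω => ?_
    simp only [Set.mem_compl_iff, Set.mem_ofPred_eq, not_lt] at hω ⊢
    have := abs_sub_le θ ((E n).estimate ω) θ₁
    rw [abs_sub_comm θ ((E n).estimate ω)] at this
    linarith

/-- The exponent at stage `n` is at most `(n * C + log 2) / (m * n * P n)`, where `P n → 1` by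
consistency at `θ`. -/
theorem bahadurBeta_le_of_maxDivergence_le (hm : 0 < m) {Θ : Set ℝ} {ρ : ℝ → State d}
    {E : (n : ℕ) → AdaptiveEstimator Ω d m n} (hE : WeaklyConsistent Θ ρ E) {θ θ₁ ε : ℝ}
    (hθ : θ ∈ Θ) (hε : ε < |θ - θ₁|) {C : ℝ} (hC0 : 0 ≤ C)
    (hC : maxDivergence.{u} ((ρ θ).tensorPow m) ((ρ θ₁).tensorPow m) ≤ ENNReal.ofReal C) :
    bahadurBeta ρ E θ₁ ε ≤ ((C / m : ℝ) : EReal) := by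
  have hP := hE.tendsto_tail hθ hε
  set P : ℕ → ℝ := fun n => (sequentialLaw (E n).rule (fun _ => (ρ θ).tensorPow m) n).real
      {ω | ε < |(E n).estimate ω - θ₁|} with hPdef
  have hm' : (0 : ℝ) < m := by exact_mod_cast hm
  have hlim : Tendsto (fun n : ℕ => (C / m + Real.log 2 / m * (n : ℝ)⁻¹) / P n) atTop
      (𝓝 (C / m)) := by
    have h1 : Tendsto (fun n : ℕ => C / m + Real.log 2 / m * (n : ℝ)⁻¹) atTop (𝓝 (C / m)) := by
      simpa using (tendsto_inv_atTop_nhds_zero_nat (𝕜 := ℝ)).const_mul (Real.log 2 / m)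
        |>.const_add (C / m)
    have h2 := h1.div hP one_ne_zero
    rw [div_one] at h2
    exact h2
  have hlim' := (continuous_coe_real_ereal.tendsto _).comp hlim
  refine (limsup_le_limsup ?_).trans_eq hlim'.limsup_eq
  filter_upwards [hP.eventually_const_lt one_pos, eventually_gt_atTop 0] with n hn hn0
  have hfin : ∀ M : POVM Ω (Fin m → d),
      klDiv (M.law ((ρ θ).tensorPow m)) (M.law ((ρ θ₁).tensorPow m)) ≤ ENNReal.ofReal C :=
    fun M => (klDiv_law_le_maxDivergence M _ _).trans hC
  obtain ⟨hQ, hle⟩ := neg_log_sequentialLaw_mul_le (E n).rule _ _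
    (fun M => ((hfin M).trans_lt ENNReal.ofReal_lt_top).ne)
    (fun M => ENNReal.toReal_le_of_le_ofReal hC0 (hfin M)) n
    ((E n).measurableSet_tail θ₁ ε) hn
  have hn' : (0 : ℝ) < n := by exact_mod_cast hn0
  rw [AdaptiveEstimator.tailProb, AdaptiveEstimator.povm_law_tensorPow,
    ENNReal.log_pos_real' hQ, ← measureReal_def, ← EReal.coe_neg, ← EReal.coe_natCast,
    ← EReal.coe_div, Function.comp_apply, EReal.coe_le_coe_iff, div_le_div_iff₀ (by positivity) hn]
  refine hle.trans_eq ?_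
  push_cast
  field_simp

theorem bahadurBeta_le_maxDivergence_div (hm : 0 < m) {Θ : Set ℝ} {ρ : ℝ → State d}
    {E : (n : ℕ) → AdaptiveEstimator Ω d m n} (hE : WeaklyConsistent Θ ρ E) {θ θ₁ ε : ℝ}
    (hθ : θ ∈ Θ) (hε : ε < |θ - θ₁|) :
    bahadurBeta ρ E θ₁ ε ≤
      ((maxDivergence.{u} ((ρ θ).tensorPow m) ((ρ θ₁).tensorPow m) / (m : ℝ≥0∞) : ℝ≥0∞) :
        EReal) := by
  rcases eq_or_ne (maxDivergence.{u} ((ρ θ).tensorPow m) ((ρ θ₁).tensorPow m)) ∞ with h | h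
  · rw [h, ENNReal.top_div_of_ne_top (ENNReal.natCast_ne_top m)]
    exact le_top
  · refine (bahadurBeta_le_of_maxDivergence_le hm hE hθ hε ENNReal.toReal_nonneg
      (ENNReal.ofReal_toReal h).ge).trans_eq ?_
    rw [← EReal.coe_ennreal_toReal (ENNReal.div_ne_top h (by exact_mod_cast hm.ne')),
      ENNReal.toReal_div, ENNReal.toReal_natCast]

end Consistency

/-! ### Quadratic bounds for relative entropy, uniform in the POVM -/

section KullbackLeibler

open InformationTheory

/-- The sharp constant `1/2` at `x = 1` is recovered as `η → 0`. Above one, `log x ≤ sinh (log x)`;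
below one, `log (1 + y) ≥ 2 * y / (y + 2)` with `y = x⁻¹ - 1` gives the denominator `1 + x ≥ 2 - η`.
-/
theorem klFun_le_sq_div {η x : ℝ} (hη0 : 0 ≤ η) (hη1 : η < 1) (hx : 1 - η ≤ x) :
    klFun x ≤ (x - 1) ^ 2 / (2 - η) := by
  have hx0 : 0 < x := by linarith
  rw [klFun_apply]
  rcases le_total 1 x with h | h
  · have h1 := Real.self_le_sinh_iff.mpr (Real.log_nonneg h)
    rw [Real.sinh_log hx0] at h1
    have h2 : x * Real.log x ≤ (x ^ 2 - 1) / 2 := by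
      refine (mul_le_mul_of_nonneg_left h1 hx0.le).trans_eq ?_
      field_simp
    have h3 : (x - 1) ^ 2 / 2 ≤ (x - 1) ^ 2 / (2 - η) :=
      div_le_div_of_nonneg_left (sq_nonneg _) (by linarith) (by linarith)
    linarith
  · have h1 := Real.le_log_one_add_of_nonneg (x := x⁻¹ - 1) (by
      rw [sub_nonneg]; exact (one_le_inv₀ hx0).mpr h)
    rw [add_sub_cancel, Real.log_inv] at h1
    have h2 : 2 * (x⁻¹ - 1) / (x⁻¹ - 1 + 2) = 2 * (1 - x) / (1 + x) := by
      have : 0 < x⁻¹ := inv_pos.mpr hx0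
      rw [div_eq_div_iff (by linarith) (by linarith)]
      field_simp
      ring
    have h3 : x * Real.log x ≤ x * -(2 * (1 - x) / (1 + x)) :=
      mul_le_mul_of_nonneg_left (by linarith) hx0.le
    have h4 : x * -(2 * (1 - x) / (1 + x)) + 1 - x = (x - 1) ^ 2 / (1 + x) := by
      field_simp
      ring
    have h5 : (x - 1) ^ 2 / (1 + x) ≤ (x - 1) ^ 2 / (2 - η) :=
      div_le_div_of_nonneg_left (sq_nonneg _) (by linarith) (by linarith)
    linarith

/-- A quantitative quadratic bound for the relative entropy. The first hypothesis says that the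
chi-squared divergence has density at most `a * c` with respect to the probability measure `κ`. -/
theorem klDiv_le_of_forall_sq_le {X : Type*} [MeasurableSpace X] {μ ν κ : Measure X}
    [IsProbabilityMeasure μ] [IsProbabilityMeasure ν] [IsProbabilityMeasure κ] {a c η : ℝ}
    (ha : 0 ≤ a) (hc : 0 < c) (hη0 : 0 ≤ η) (hη1 : η < 1)
    (hsq : ∀ (t : ℝ) (B : Set X), MeasurableSet B →
      2 * t * (μ.real B - ν.real B) ≤ a * κ.real B + c * t ^ 2 * ν.real B)
    (hlow : ∀ B, MeasurableSet B → (1 - η) * ν.real B ≤ μ.real B)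
    (hμν : μ ≪ ν) (hκν : κ ≪ ν) :
    klDiv μ ν ≤ ENNReal.ofReal (a * c / (2 - η)) := by
  set g : X → ℝ := fun x => (μ.rnDeriv ν x).toReal with hg
  set k : X → ℝ := fun x => (κ.rnDeriv ν x).toReal with hk
  have hgi : Integrable g ν := Measure.integrable_toReal_rnDeriv
  have hki : Integrable k ν := Measure.integrable_toReal_rnDeriv
  have hgB : ∀ B, ∫ x in B, g x ∂ν = μ.real B := Measure.setIntegral_toReal_rnDeriv hμν
  have hkB : ∀ B, ∫ x in B, k x ∂ν = κ.real B := Measure.setIntegral_toReal_rnDeriv hκν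
  -- Rational parameters allow one null set for all of them; continuity extends the inequality to
  -- real `t`.
  have h1 : ∀ᵐ x ∂ν, ∀ q : ℚ, 2 * (q : ℝ) * (g x - 1) ≤ a * k x + c * (q : ℝ) ^ 2 := by
    rw [ae_all_iff]
    intro q
    refine ae_le_of_forall_setIntegral_le ((hgi.sub (integrable_const 1)).const_mul _)
      ((hki.const_mul a).add (integrable_const _)) fun B hB _ => ?_
    rw [integral_const_mul, integral_sub hgi.integrableOn (integrable_const 1),
      integral_add (hki.const_mul a).integrableOn (integrable_const _), integral_const_mul, hgB, hkB]
    simpa [mul_comm] using hsq q B hB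
  have h2 : ∀ᵐ x ∂ν, 1 - η ≤ g x := by
    refine ae_le_of_forall_setIntegral_le (integrable_const _) hgi fun B hB _ => ?_
    rw [hgB]
    simpa [mul_comm] using hlow B hB
  rw [klDiv_eq_lintegral_klFun_of_ac hμν]
  calc ∫⁻ x, ENNReal.ofReal (klFun (g x)) ∂ν
      ≤ ∫⁻ x, ENNReal.ofReal (a * c / (2 - η)) * κ.rnDeriv ν x ∂ν := by
        refine lintegral_mono_ae ?_
        filter_upwards [h1, h2, κ.rnDeriv_lt_top ν] with x hx1 hx2 hx3
        have hx4 : ∀ t : ℝ, 2 * t * (g x - 1) ≤ a * k x + c * t ^ 2 := fun t =>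
          isClosed_property (p := fun t : ℝ => 2 * t * (g x - 1) ≤ a * k x + c * t ^ 2)
            Rat.isDenseEmbedding_coe_real.dense (isClosed_le (by fun_prop) (by fun_prop)) hx1 t
        have hx5 : (g x - 1) ^ 2 ≤ a * c * k x := by
          -- The optimal `t` for the quadratic inequality.
          have h := hx4 ((g x - 1) / c)
          have e1 : 2 * ((g x - 1) / c) * (g x - 1) = 2 * (g x - 1) ^ 2 / c := by ring
          have e2 : c * ((g x - 1) / c) ^ 2 = (g x - 1) ^ 2 / c := by field_simp
          rw [e1, e2] at h
          have h' : (g x - 1) ^ 2 / c ≤ a * k x := by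
            have : 2 * (g x - 1) ^ 2 / c = (g x - 1) ^ 2 / c + (g x - 1) ^ 2 / c := by ring
            linarith
          rw [div_le_iff₀ hc] at h'
          linarith
        rw [← ENNReal.ofReal_toReal hx3.ne, ← ENNReal.ofReal_mul (div_nonneg (by positivity)
          (by linarith))]
        refine ENNReal.ofReal_le_ofReal ((klFun_le_sq_div hη0 hη1 hx2).trans ?_)
        rw [div_mul_eq_mul_div]
        exact div_le_div_of_nonneg_right hx5 (by linarith)
    _ = ENNReal.ofReal (a * c / (2 - η)) * ∫⁻ x, κ.rnDeriv ν x ∂ν :=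
        lintegral_const_mul _ (Measure.measurable_rnDeriv _ _)
    _ = ENNReal.ofReal (a * c / (2 - η)) := by
        rw [Measure.lintegral_rnDeriv hκν]
        simp

variable {Ω : Type*} [MeasurableSpace Ω] {ι : Type*} [Fintype ι] [DecidableEq ι]

theorem POVM.law_real_apply (M : POVM Ω ι) (ρ : State ι) {B : Set Ω} (hB : MeasurableSet B) :
    (M.law ρ).real B = (ρ.1 * M.toFun B).trace.re := by
  rw [measureReal_def, M.law_apply ρ hB,
    ENNReal.toReal_ofReal (trace_mul_re_nonneg ρ.2.1 (M.posSemidef B hB))]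

theorem POVM.law_absolutelyContinuous (M : POVM Ω ι) {ρ σ : State ι} {c : ℝ}
    (h : (c • σ.1 - ρ.1).PosSemidef) : M.law ρ ≪ M.law σ := by
  refine Measure.AbsolutelyContinuous.mk fun B hB hσ => ?_
  have h0 := trace_mul_re_nonneg h (M.posSemidef B hB)
  simp only [Matrix.sub_mul, Matrix.smul_mul, Matrix.trace_sub, Matrix.trace_smul, Complex.sub_re,
    Complex.real_smul, Complex.re_ofReal_mul, ← M.law_real_apply _ hB] at h0
  rw [measureReal_def (M.law σ), hσ] at h0
  rw [← measureReal_eq_zero_iff]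
  exact le_antisymm (by simpa using h0) measureReal_nonneg

/-- A bound on the relative entropy of measurement data, uniform in the measurement, from operator
inequalities between the states. -/
theorem maxDivergence_le_of_posSemidef {ρ σ τ : State ι} {a c η b₁ b₂ : ℝ}
    (ha : 0 ≤ a) (hc : 0 < c) (hη0 : 0 ≤ η) (hη1 : η < 1)
    (hsq : ∀ t : ℝ, (a • τ.1 + (c * t ^ 2) • σ.1 - (2 * t) • (ρ.1 - σ.1)).PosSemidef)
    (hlow : (ρ.1 - (1 - η) • σ.1).PosSemidef)
    (hρ : (b₁ • σ.1 - ρ.1).PosSemidef) (hτ : (b₂ • σ.1 - τ.1).PosSemidef) :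
    maxDivergence.{u} ρ σ ≤ ENNReal.ofReal (a * c / (2 - η)) := by
  refine iSup_le fun Ω => iSup₂_le fun _ M => ?_
  refine klDiv_le_of_forall_sq_le (κ := M.law τ) ha hc hη0 hη1 (fun t B hB => ?_) (fun B hB => ?_)
    (M.law_absolutelyContinuous hρ) (M.law_absolutelyContinuous hτ)
  · have h0 := trace_mul_re_nonneg (hsq t) (M.posSemidef B hB)
    simp only [Matrix.sub_mul, Matrix.add_mul, Matrix.smul_mul, Matrix.trace_sub, Matrix.trace_add,
      Matrix.trace_smul, Complex.sub_re, Complex.add_re, Complex.real_smul, Complex.re_ofReal_mul,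
      ← M.law_real_apply _ hB] at h0
    linarith
  · have h0 := trace_mul_re_nonneg hlow (M.posSemidef B hB)
    simp only [Matrix.sub_mul, Matrix.smul_mul, Matrix.trace_sub, Matrix.trace_smul, Complex.sub_re,
      Complex.real_smul, Complex.re_ofReal_mul, ← M.law_real_apply _ hB] at h0
    linarith

end KullbackLeibler

/-! ### Operator inequalities and the second-order expansion -/

section Operators

/-- The difference is a combination of `S - A` and `S + A` with nonnegative weights `(r ± s) / 2`.
-/
theorem posSemidef_smul_sub_smul {ι : Type*} {A S : Matrix ι ι ℂ} (h1 : (S - A).PosSemidef)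
    (h2 : (S + A).PosSemidef) {r s : ℝ} (h : |s| ≤ r) : (r • S - s • A).PosSemidef := by
  have h3 : r • S - s • A = ((r + s) / 2) • (S - A) + ((r - s) / 2) • (S + A) := by module
  obtain ⟨h4, h5⟩ := abs_le.mp h
  rw [h3]
  exact (h1.smul (by linarith)).add (h2.smul (by linarith))

theorem isHermitian_of_isSLD {ι : Type*} [Fintype ι] {σ ρ' L : Matrix ι ι ℂ} (hσ : σ.IsHermitian) (hL : IsSLD σ ρ' L) :
    ρ'.IsHermitian := by
  rw [← hL.2]
  simp [Matrix.IsHermitian, Matrix.conjTranspose_smul, Matrix.conjTranspose_mul, hσ.eq, hL.1.eq,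
    add_comm]

theorem trace_mul_mul_eq_sldFisher {ι : Type*} [Fintype ι] {σ L : Matrix ι ι ℂ} (hσ : σ.PosSemidef) (hL : L.IsHermitian) :
    (L * σ * L).PosSemidef ∧ (L * σ * L).trace = (sldFisher σ L : ℂ) ∧ 0 ≤ sldFisher σ L := by
  have h1 : (L * σ * L).PosSemidef := by
    simpa [hL.eq] using hσ.conjTranspose_mul_mul_same L
  have h2 : (L * L * σ).trace = (L * σ * L).trace := (Matrix.trace_mul_cycle L σ L).symm
  have h3 := Complex.nonneg_iff.mp h1.trace_nonneg
  refine ⟨h1, Complex.ext ?_ ?_, ?_⟩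
  · simp [sldFisher, h2]
  · simpa using h3.2.symm
  · simpa [sldFisher, h2] using h3.1

variable {ι : Type*} [Fintype ι] [DecidableEq ι]

/-- A generalized inverse: a linear section of `B` over its range, extended to the whole space. It
replaces inversion for states without full support. -/
theorem exists_mul_mul_self_eq (B : Matrix ι ι ℂ) : ∃ G : Matrix ι ι ℂ, B * G * B = B := by
  set f := Matrix.toLin' B with hf
  obtain ⟨s, hs⟩ := f.rangeRestrict.exists_rightInverse_of_surjective f.range_rangeRestrict
  obtain ⟨g, hg⟩ := s.exists_extend
  refine ⟨LinearMap.toMatrix' g, Matrix.toLin'.injective ?_⟩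
  rw [Matrix.toLin'_mul, Matrix.toLin'_mul, Matrix.toLin'_toMatrix', ← hf]
  refine LinearMap.ext fun v => ?_
  have h1 : g (f v) = s (f.rangeRestrict v) := LinearMap.congr_fun hg (f.rangeRestrict v)
  have h2 : f (s (f.rangeRestrict v)) = f v :=
    congrArg Subtype.val (LinearMap.congr_fun hs (f.rangeRestrict v))
  simp only [LinearMap.comp_apply, h1, h2]

/-- An operator that vanishes on the kernel of `σ` factors through `σ`. -/
theorem exists_eq_mul_of_ker_le {A σ : Matrix ι ι ℂ}
    (h : ∀ v : ι → ℂ, σ *ᵥ v = 0 → A *ᵥ v = 0) : ∃ X : Matrix ι ι ℂ, A = X * σ := by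
  obtain ⟨G, hG⟩ := exists_mul_mul_self_eq σ
  refine ⟨A * G, Matrix.toLin'.injective (LinearMap.ext fun v => ?_)⟩
  have h0 : σ *ᵥ (v - (G * σ) *ᵥ v) = 0 := by
    rw [Matrix.mulVec_sub, Matrix.mulVec_mulVec, ← Matrix.mul_assoc, hG, sub_self]
  have h1 := h _ h0
  rw [Matrix.mulVec_sub, Matrix.mulVec_mulVec, ← Matrix.mul_assoc, sub_eq_zero] at h1
  exact h1

open scoped MatrixOrder Matrix.Norms.L2Operator in
/-- A Hermitian operator supported in the support of `σ ≥ 0` is bounded by a multiple of `σ` that is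
proportional to its norm. -/
theorem exists_posSemidef_smul_norm_sub {σ : Matrix ι ι ℂ} (hσ : σ.PosSemidef) :
    ∃ c : ℝ, 0 ≤ c ∧ ∀ A : Matrix ι ι ℂ, A.IsHermitian →
      (∀ v : ι → ℂ, σ *ᵥ v = 0 → A *ᵥ v = 0) → ((c * ‖A‖) • σ - A).PosSemidef := by
  obtain ⟨B, hB⟩ := CStarAlgebra.nonneg_iff_eq_star_mul_self.mp hσ.nonneg
  rw [Matrix.star_eq_conjTranspose] at hB
  obtain ⟨G, hG⟩ := exists_mul_mul_self_eq B
  refine ⟨‖Gᴴ‖ * ‖G‖, by positivity, fun A hA hker => ?_⟩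
  obtain ⟨Y, hY⟩ := exists_eq_mul_of_ker_le (A := A) (σ := B) fun v hv => hker v <| by
    rw [hB, ← Matrix.mulVec_mulVec, hv, Matrix.mulVec_zero]
  have h1 : A * G * B = A := by rw [hY, Matrix.mul_assoc, Matrix.mul_assoc, ← Matrix.mul_assoc B, hG]
  have h2 : Bᴴ * Gᴴ * A = A := by
    have := congrArg Matrix.conjTranspose h1
    simpa [Matrix.conjTranspose_mul, hA.eq, Matrix.mul_assoc] using this
  -- Compressing by `G` writes `A = Bᴴ * Z * B`, so the bound of `Z` by its norm becomes a bound of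
  -- `A` by a multiple of `Bᴴ * B = σ`.
  set Z := Gᴴ * A * G with hZ
  have hZA : Bᴴ * Z * B = A := by
    calc Bᴴ * Z * B = (Bᴴ * Gᴴ * A) * G * B := by simp only [hZ, Matrix.mul_assoc]
      _ = A := by rw [h2, h1]
  have hZh : IsSelfAdjoint Z := by
    rw [hZ, IsSelfAdjoint, Matrix.star_eq_conjTranspose]
    simp [Matrix.conjTranspose_mul, hA.eq, Matrix.mul_assoc]
  have hZle : Z ≤ algebraMap ℝ _ (‖Gᴴ‖ * ‖G‖ * ‖A‖) := by
    refine hZh.le_algebraMap_norm_self.trans (algebraMap_mono _ ?_)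
    calc ‖Z‖ ≤ ‖Gᴴ‖ * ‖A‖ * ‖G‖ := norm_mul₃_le
      _ = _ := by ring
  have h3 := (Matrix.le_iff.mp hZle).conjTranspose_mul_mul_same B
  rw [Matrix.mul_sub, Matrix.sub_mul, hZA, Algebra.algebraMap_eq_smul_one, Matrix.mul_smul,
    Matrix.mul_one, Matrix.smul_mul, ← hB] at h3
  exact h3

/-- Operator form of the Cramér–Rao bound for the chi-squared divergence: `ρ = σ + h (ρ' + A)`,
where `ρ'` has logarithmic derivative `L` and the error `A` is bounded by `S`. -/
theorem posSemidef_sq_sub {σ ρ' L A : Matrix ι ι ℂ} (hσ : σ.PosSemidef) (hL : IsSLD σ ρ' L) {κ : ℝ}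
    (hA1 : (κ • σ - A).PosSemidef) (hA2 : (κ • σ + A).PosSemidef) (h t : ℝ) :
    (h ^ 2 • (L * σ * L + κ • σ) + ((1 + κ) * t ^ 2) • σ -
      (2 * t) • (h • (ρ' + A))).PosSemidef := by
  -- The cross terms of this square are `-(t * h) • (L * σ + σ * L) = -(2 * t * h) • ρ'`; the error
  -- `A` is absorbed through `|2 * t * h| ≤ h ^ 2 + t ^ 2`.
  have h1 := hσ.conjTranspose_mul_mul_same (h • L - t • (1 : Matrix ι ι ℂ))
  have h2 : (h • L - t • (1 : Matrix ι ι ℂ))ᴴ = h • L - t • (1 : Matrix ι ι ℂ) := by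
    simp [Matrix.conjTranspose_sub, Matrix.conjTranspose_smul, hL.1.eq]
  have h3 : ρ' = (1 / 2 : ℝ) • (L * σ + σ * L) := by
    rw [← hL.2]
    ext i j
    simp [Complex.real_smul, mul_add]
  have h4 : |2 * t * h| ≤ h ^ 2 + t ^ 2 :=
    abs_le.mpr ⟨by nlinarith [sq_nonneg (h + t)], by nlinarith [sq_nonneg (h - t)]⟩
  have h5 := (h1.add (posSemidef_smul_sub_smul hA1 hA2 h4))
  rw [h2] at h5
  convert h5 using 1
  rw [h3]
  simp only [Matrix.sub_mul, Matrix.mul_sub, Matrix.smul_mul, Matrix.mul_smul, Matrix.one_mul,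
    Matrix.mul_one]
  module

/-- The mixture of the directions `L σ L` and `σ`, normalized to a state. -/
theorem exists_state_smul_eq {ι : Type*} [Fintype ι] {σ L : Matrix ι ι ℂ} (hσ : σ.PosSemidef) (hσ1 : σ.trace = 1)
    (hL : L.IsHermitian) {κ : ℝ} (hκ : 0 < κ) :
    ∃ τ : State ι, τ.1 = (sldFisher σ L + κ)⁻¹ • (L * σ * L + κ • σ) := by
  obtain ⟨h1, h2, h3⟩ := trace_mul_mul_eq_sldFisher hσ hL
  have h4 : 0 < sldFisher σ L + κ := by linarith
  refine ⟨⟨_, (h1.add (hσ.smul hκ.le)).smul (inv_nonneg.mpr h4.le), ?_⟩, rfl⟩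
  rw [Matrix.trace_smul, Matrix.trace_add, Matrix.trace_smul, h2, hσ1, Complex.real_smul,
    Complex.real_smul, mul_one, ← Complex.ofReal_add, ← Complex.ofReal_mul, inv_mul_cancel₀ h4.ne',
    Complex.ofReal_one]

open scoped Matrix.Norms.L2Operator in
/-- Second-order upper bound for the divergence of measurement data along a differentiable family of
states. -/
theorem eventually_maxDivergence_le {Θ : Set ℝ} {θ₁ : ℝ} {ρ : ℝ → State ι}
    (hsupp : ∀ᶠ θ in 𝓝[Θ] θ₁, ∀ v : ι → ℂ, (ρ θ₁).1 *ᵥ v = 0 → (ρ θ).1 *ᵥ v = 0)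
    {ρ' L : Matrix ι ι ℂ}
    (hderiv : ∀ i j, HasDerivWithinAt (fun θ => (ρ θ).1 i j) (ρ' i j) Θ θ₁)
    (hL : IsSLD (ρ θ₁).1 ρ' L) {J : ℝ} (hJ : sldFisher (ρ θ₁).1 L < J) :
    ∀ᶠ θ in 𝓝[Θ \ {θ₁}] θ₁,
      maxDivergence.{u} (ρ θ) (ρ θ₁) ≤ ENNReal.ofReal (J / 2 * (θ - θ₁) ^ 2) := by
  set σ := (ρ θ₁).1 with hσdef
  have hσ : σ.PosSemidef := (ρ θ₁).2.1
  rcases eq_or_neBot (𝓝[Θ \ {θ₁}] θ₁) with hbot | hne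
  · rw [hbot]
    exact eventually_bot
  set S : ℝ → Matrix ι ι ℂ := fun θ => (θ - θ₁)⁻¹ • ((ρ θ).1 - σ) with hS
  have hS_lim : Tendsto S (𝓝[Θ \ {θ₁}] θ₁) (𝓝 ρ') :=
    tendsto_pi_nhds.mpr fun i => tendsto_pi_nhds.mpr fun j =>
      hasDerivWithinAt_iff_tendsto_slope.mp (hderiv i j)
  have hsupp' : ∀ᶠ θ in 𝓝[Θ \ {θ₁}] θ₁,
      ∀ v : ι → ℂ, σ *ᵥ v = 0 → (ρ θ).1 *ᵥ v = 0 :=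
    hsupp.filter_mono (nhdsWithin_mono _ Set.sdiff_subset)
  have hker' : ∀ v : ι → ℂ, σ *ᵥ v = 0 → ρ' *ᵥ v = 0 := fun v hv => by
    have h1 : Tendsto (fun θ => S θ *ᵥ v) (𝓝[Θ \ {θ₁}] θ₁) (𝓝 (ρ' *ᵥ v)) :=
      ((continuous_id.matrix_mulVec continuous_const).tendsto ρ').comp hS_lim
    refine tendsto_nhds_unique h1 (tendsto_const_nhds.congr' ?_)
    filter_upwards [hsupp'] with θ hθ
    rw [hS, Matrix.smul_mulVec, Matrix.sub_mulVec, hθ v hv, hv, sub_zero, smul_zero]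
  obtain ⟨c, hc0, hc⟩ := exists_posSemidef_smul_norm_sub hσ
  -- The left side is `a * c / (2 - η)` divided by `(θ - θ₁) ^ 2`, for the parameters used at the
  -- end; at `κ = 0` it equals half the SLD information.
  obtain ⟨κ, hκJ, hκ0, hκ1⟩ : ∃ κ : ℝ,
      (sldFisher σ L + κ) * (1 + κ) / (2 - κ) < J / 2 ∧ 0 < κ ∧ κ < 1 := by
    have h1 : ContinuousAt (fun κ : ℝ => (sldFisher σ L + κ) * (1 + κ) / (2 - κ)) 0 :=
      ContinuousAt.div (by fun_prop) (by fun_prop) (by norm_num)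
    have h2 : ∀ᶠ κ in 𝓝 (0 : ℝ), (sldFisher σ L + κ) * (1 + κ) / (2 - κ) < J / 2 :=
      h1.eventually_lt continuousAt_const (by simpa using by linarith)
    have h3 : ∀ᶠ κ in 𝓝[>] (0 : ℝ), κ < 1 :=
      (eventually_lt_nhds one_pos).filter_mono nhdsWithin_le_nhds
    have h4 : ∀ᶠ κ in 𝓝[>] (0 : ℝ), 0 < κ := self_mem_nhdsWithin
    exact ((h2.filter_mono nhdsWithin_le_nhds).and (h4.and h3)).exists
  obtain ⟨τ, hτ⟩ := exists_state_smul_eq hσ (ρ θ₁).2.2 hL.1 hκ0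
  obtain ⟨hLL, -, hJ0⟩ := trace_mul_mul_eq_sldFisher hσ hL.1
  have hJκ : 0 < sldFisher σ L + κ := by linarith
  have hτσ : ((c * ‖τ.1‖) • σ - τ.1).PosSemidef := by
    refine hc _ τ.2.1.isHermitian fun v hv => ?_
    -- On the kernel of `σ` the SLD equation reduces to `σ * L = 2 • ρ'`, and `ρ'` vanishes there as
    -- a limit of difference quotients. So `L * σ * L`, hence `τ`, is supported in the support of
    -- `σ`.
    have h1 : σ *ᵥ (L *ᵥ v) = 0 := by
      have h2 := hker' v hv
      rw [← hL.2, Matrix.smul_mulVec, smul_eq_zero_iff_right (by norm_num), Matrix.add_mulVec,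
        ← Matrix.mulVec_mulVec, hv, Matrix.mulVec_zero, zero_add, ← Matrix.mulVec_mulVec] at h2
      exact h2
    rw [hτ, Matrix.smul_mulVec, Matrix.add_mulVec, Matrix.smul_mulVec, hv, ← Matrix.mulVec_mulVec,
      ← Matrix.mulVec_mulVec, h1]
    simp
  have hA_small : ∀ᶠ θ in 𝓝[Θ \ {θ₁}] θ₁, c * ‖S θ - ρ'‖ < κ := by
    have h1 : Tendsto (fun θ => c * ‖S θ - ρ'‖) (𝓝[Θ \ {θ₁}] θ₁) (𝓝 (c * ‖ρ' - ρ'‖)) :=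
      ((hS_lim.sub_const ρ').norm).const_mul c
    rw [sub_self, norm_zero, mul_zero] at h1
    exact h1.eventually_lt_const hκ0
  have hD_small : ∀ᶠ θ in 𝓝[Θ \ {θ₁}] θ₁, c * ‖(θ - θ₁) • S θ‖ < κ := by
    have h0 : Tendsto (fun θ : ℝ => θ - θ₁) (𝓝[Θ \ {θ₁}] θ₁) (𝓝 0) := by
      have : Tendsto (fun θ : ℝ => θ - θ₁) (𝓝 θ₁) (𝓝 (θ₁ - θ₁)) :=
        (continuous_id.sub continuous_const).tendsto θ₁
      rw [sub_self] at this
      exact this.mono_left nhdsWithin_le_nhds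
    have h1 := ((h0.smul hS_lim).norm).const_mul c
    rw [zero_smul, norm_zero, mul_zero] at h1
    exact h1.eventually_lt_const hκ0
  have bound : ∀ (A : Matrix ι ι ℂ), A.IsHermitian → (∀ v : ι → ℂ, σ *ᵥ v = 0 → A *ᵥ v = 0) →
      c * ‖A‖ < κ → (κ • σ - A).PosSemidef ∧ (κ • σ + A).PosSemidef := fun A hA hker hlt => by
    have h1 := hc A hA hker
    have h2 := hc (-A) hA.neg fun v hv => by rw [Matrix.neg_mulVec, hker v hv, neg_zero]
    have h3 := hσ.smul (sub_nonneg.mpr hlt.le)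
    refine ⟨?_, ?_⟩
    · convert h3.add h1 using 1
      module
    · rw [norm_neg] at h2
      convert h3.add h2 using 1
      module
  filter_upwards [hsupp', hA_small, hD_small, self_mem_nhdsWithin] with θ hθ hA hD hmem
  have hh : θ - θ₁ ≠ 0 := sub_ne_zero.mpr fun h => hmem.2 h
  have hDeq : (θ - θ₁) • S θ = (ρ θ).1 - σ := smul_inv_smul₀ hh _
  have hDherm : ((ρ θ).1 - σ).IsHermitian := (ρ θ).2.1.isHermitian.sub hσ.isHermitian
  have hDker : ∀ v : ι → ℂ, σ *ᵥ v = 0 → ((ρ θ).1 - σ) *ᵥ v = 0 := fun v hv => by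
    rw [Matrix.sub_mulVec, hθ v hv, hv, sub_zero]
  have hSherm : (S θ).IsHermitian := by
    rw [Matrix.IsHermitian, hS, Matrix.conjTranspose_smul, hDherm.eq, star_trivial]
  have hSker : ∀ v : ι → ℂ, σ *ᵥ v = 0 → S θ *ᵥ v = 0 := fun v hv => by
    rw [hS, Matrix.smul_mulVec, hDker v hv, smul_zero]
  rw [hDeq] at hD
  obtain ⟨hA1, hA2⟩ := bound (S θ - ρ') (hSherm.sub (isHermitian_of_isSLD hσ.isHermitian hL))
    (fun v hv => by rw [Matrix.sub_mulVec, hSker v hv, hker' v hv, sub_zero]) hA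
  obtain ⟨hD1, hD2⟩ := bound _ hDherm hDker hD
  refine (maxDivergence_le_of_posSemidef (τ := τ) (a := (θ - θ₁) ^ 2 * (sldFisher σ L + κ))
    (c := 1 + κ) (η := κ) (b₁ := 1 + κ) (by positivity) (by linarith) hκ0.le hκ1 (fun t => ?_) ?_ ?_
    hτσ).trans (ENNReal.ofReal_le_ofReal ?_)
  · convert posSemidef_sq_sub hσ hL hA1 hA2 (θ - θ₁) t using 1
    rw [hτ, mul_smul, smul_inv_smul₀ hJκ.ne', add_sub_cancel, hDeq]
  · convert hD2 using 1
    module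
  · convert hD1 using 1
    module
  · calc (θ - θ₁) ^ 2 * (sldFisher σ L + κ) * (1 + κ) / (2 - κ)
        = (sldFisher σ L + κ) * (1 + κ) / (2 - κ) * (θ - θ₁) ^ 2 := by ring
      _ ≤ _ := mul_le_mul_of_nonneg_right hκJ.le (sq_nonneg _)

end Operators

/-! ### Derivatives, supports and SLD information of tensor powers -/

section TensorPower

theorem tensorMatrix_update_apply {ι : Type*} {n : ℕ} (f : Fin n → Matrix ι ι ℂ) (l : Fin n)
    (A : Matrix ι ι ℂ) (x y : Fin n → ι) :
    tensorMatrix (Function.update f l A) x y =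
      (∏ j ∈ Finset.univ.erase l, f j (x j) (y j)) * A (x l) (y l) := by
  rw [tensorMatrix, Matrix.of_apply, ← Finset.prod_erase_mul _ _ (Finset.mem_univ l),
    Function.update_self]
  congr 1
  refine Finset.prod_congr rfl fun j hj => ?_
  rw [Function.update_of_ne (Finset.ne_of_mem_erase hj)]

/-- The sum over the tensor factors of `A` acting on one factor and `B` on the others. -/
def tensorSum {ι : Type*} (n : ℕ) (A B : Matrix ι ι ℂ) : Matrix (Fin n → ι) (Fin n → ι) ℂ :=
  ∑ l : Fin n, tensorMatrix (Function.update (fun _ => B) l A)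

theorem tensorSum_linear_combination {ι : Type*} (n : ℕ) (a : ℂ) (A A' B : Matrix ι ι ℂ) :
    a • (tensorSum n A B + tensorSum n A' B) = tensorSum n (a • (A + A')) B := by
  simp only [tensorSum, ← Finset.sum_add_distrib, Finset.smul_sum]
  refine Finset.sum_congr rfl fun l _ => ?_
  ext x y
  simp only [Matrix.smul_apply, Matrix.add_apply, tensorMatrix_update_apply, smul_eq_mul]
  ring

theorem hasDerivWithinAt_tensorMatrix {ι : Type*} {n : ℕ} {ρ : ℝ → Matrix ι ι ℂ}
    {ρ' : Matrix ι ι ℂ} {Θ : Set ℝ} {θ₁ : ℝ}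
    (h : ∀ i j, HasDerivWithinAt (fun θ => ρ θ i j) (ρ' i j) Θ θ₁) (x y : Fin n → ι) :
    HasDerivWithinAt (fun θ => tensorMatrix (fun _ : Fin n => ρ θ) x y)
      (tensorSum n ρ' (ρ θ₁) x y) Θ θ₁ := by
  have h1 := HasDerivWithinAt.fun_finsetProd (u := Finset.univ)
    fun (l : Fin n) _ => h (x l) (y l)
  refine h1.congr_deriv ?_
  rw [tensorSum, Matrix.sum_apply]
  exact Finset.sum_congr rfl fun l _ => by rw [tensorMatrix_update_apply, smul_eq_mul]

variable {ι : Type*} [Fintype ι]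

/-- Kernel inclusion means `ρ = X * σ`, and this factorization passes to tensor powers. -/
theorem tensorMatrix_ker_le {n : ℕ} [DecidableEq ι] {ρ σ : Matrix ι ι ℂ}
    (h : ∀ v : ι → ℂ, σ *ᵥ v = 0 → ρ *ᵥ v = 0) (v : (Fin n → ι) → ℂ)
    (hv : tensorMatrix (fun _ : Fin n => σ) *ᵥ v = 0) :
    tensorMatrix (fun _ : Fin n => ρ) *ᵥ v = 0 := by
  obtain ⟨X, hX⟩ := exists_eq_mul_of_ker_le h
  have h1 : tensorMatrix (fun _ : Fin n => ρ) =
      tensorMatrix (fun _ : Fin n => X) * tensorMatrix (fun _ : Fin n => σ) := by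
    rw [tensorMatrix_mul, hX]
  rw [h1, ← Matrix.mulVec_mulVec, hv, Matrix.mulVec_zero]

variable [DecidableEq ι]

theorem tensorMatrix_update_mul_left (n : ℕ) (l : Fin n) (A σ : Matrix ι ι ℂ) :
    tensorMatrix (Function.update (fun _ : Fin n => (1 : Matrix ι ι ℂ)) l A) *
      tensorMatrix (fun _ : Fin n => σ) =
        tensorMatrix (Function.update (fun _ => σ) l (A * σ)) := by
  rw [tensorMatrix_mul]
  congr 1
  funext j
  rcases eq_or_ne j l with rfl | h
  · simp
  · simp [h]

theorem tensorMatrix_update_mul_right (n : ℕ) (l : Fin n) (A σ : Matrix ι ι ℂ) :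
    tensorMatrix (fun _ : Fin n => σ) *
      tensorMatrix (Function.update (fun _ : Fin n => (1 : Matrix ι ι ℂ)) l A) =
        tensorMatrix (Function.update (fun _ => σ) l (σ * A)) := by
  rw [tensorMatrix_mul]
  congr 1
  funext j
  rcases eq_or_ne j l with rfl | h
  · simp
  · simp [h]

theorem tensorSum_isHermitian {ι : Type*} [DecidableEq ι] (n : ℕ) {L : Matrix ι ι ℂ} (hL : L.IsHermitian) :
    (tensorSum n L 1).IsHermitian := by
  rw [Matrix.IsHermitian, tensorSum, Matrix.conjTranspose_sum]
  refine Finset.sum_congr rfl fun l _ => ?_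
  rw [tensorMatrix_conjTranspose]
  congr 1
  funext j
  rcases eq_or_ne j l with rfl | h
  · simp [hL.eq]
  · simp [h]

theorem isSLD_tensorSum (n : ℕ) {σ ρ' L : Matrix ι ι ℂ} (hL : IsSLD σ ρ' L) :
    IsSLD (tensorMatrix fun _ : Fin n => σ) (tensorSum n ρ' σ) (tensorSum n L 1) := by
  refine ⟨tensorSum_isHermitian n hL.1, ?_⟩
  have h1 : tensorSum n L 1 * (tensorMatrix fun _ : Fin n => σ) = tensorSum n (L * σ) σ := by
    rw [tensorSum, Finset.sum_mul]
    exact Finset.sum_congr rfl fun l _ => tensorMatrix_update_mul_left n l L σ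
  have h2 : (tensorMatrix fun _ : Fin n => σ) * tensorSum n L 1 = tensorSum n (σ * L) σ := by
    rw [tensorSum, Finset.mul_sum]
    exact Finset.sum_congr rfl fun l _ => tensorMatrix_update_mul_right n l L σ
  rw [h1, h2, tensorSum_linear_combination, hL.2]

/-- The SLD Fisher information is additive on tensor powers. -/
theorem sldFisher_tensorSum (n : ℕ) {σ L : Matrix ι ι ℂ} (hσ : σ.trace = 1)
    (hL : (L * σ).trace = 0) :
    sldFisher (tensorMatrix fun _ : Fin n => σ) (tensorSum n L 1) = n * sldFisher σ L := by
  -- For `k ≠ l` the trace contains the factor `Tr (L * σ) = 0`, so only the `n` diagonal terms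
  -- survive.
  have h1 : ∀ k l : Fin n,
      (tensorMatrix (Function.update (fun _ : Fin n => (1 : Matrix ι ι ℂ)) k L) *
        tensorMatrix (Function.update (fun _ : Fin n => (1 : Matrix ι ι ℂ)) l L) *
        tensorMatrix (fun _ : Fin n => σ)).trace =
      if k = l then (L * L * σ).trace else 0 := fun k l => by
    rw [tensorMatrix_mul, tensorMatrix_mul, trace_tensorMatrix]
    split_ifs with hkl
    · subst hkl
      rw [Finset.prod_eq_single k (fun j _ hj => by simp [hj, hσ]) (by simp)]
      simp
    · exact Finset.prod_eq_zero (Finset.mem_univ k) (by simp [hkl, hL])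
  simp only [sldFisher, tensorSum, Finset.sum_mul, Finset.mul_sum, Matrix.trace_sum, h1]
  simp

end TensorPower

/-! ### The local bound -/

section LocalBound

variable {Ω : Type u} [MeasurableSpace Ω] {d : Type*} [Fintype d] [DecidableEq d] {m : ℕ}

/-- The trace of `ρ θ` is constantly one, so `Tr ρ' = 0`, and the SLD equation gives `Tr ρ' = Tr (L
* ρ θ₁)`. Unique differentiability makes the derivative of the constant trace unambiguous. -/
theorem trace_mul_eq_zero_of_isSLD {d : Type*} [Fintype d] {Θ : Set ℝ} {ρ : ℝ → State d} {θ₁ : ℝ}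
    (hΘ : UniqueDiffWithinAt ℝ Θ θ₁) {ρ' L : Matrix d d ℂ}
    (hderiv : ∀ i j, HasDerivWithinAt (fun θ => (ρ θ).1 i j) (ρ' i j) Θ θ₁)
    (hL : IsSLD (ρ θ₁).1 ρ' L) : (L * (ρ θ₁).1).trace = 0 := by
  have h1 : HasDerivWithinAt (fun θ => (ρ θ).1.trace) ρ'.trace Θ θ₁ :=
    HasDerivWithinAt.fun_sum fun i _ => hderiv i i
  simp only [(ρ _).2.2] at h1
  have h2 : ρ'.trace = 0 := hΘ.eq_deriv _ h1 (hasDerivWithinAt_const θ₁ Θ 1)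
  rw [← hL.2, Matrix.trace_smul, Matrix.trace_add, Matrix.trace_mul_comm (ρ θ₁).1, ← two_mul,
    smul_eq_mul, ← mul_assoc] at h2
  simpa using h2

theorem bahadurAlpha_le_sldFisher_div_two (hm : 0 < m) {Θ : Set ℝ} {ρ : ℝ → State d}
    {E : (n : ℕ) → AdaptiveEstimator Ω d m n} (hE : WeaklyConsistent Θ ρ E) {θ₁ : ℝ}
    (hΘ : Θ ∈ 𝓝[>] θ₁ ∨ Θ ∈ 𝓝[<] θ₁)
    (hsupp : ∀ᶠ θ in 𝓝[Θ] θ₁, ∀ v : d → ℂ, (ρ θ₁).1 *ᵥ v = 0 → (ρ θ).1 *ᵥ v = 0)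
    {ρ' L : Matrix d d ℂ}
    (hderiv : ∀ i j, HasDerivWithinAt (fun θ => (ρ θ).1 i j) (ρ' i j) Θ θ₁)
    (hL : IsSLD (ρ θ₁).1 ρ' L) :
    bahadurAlpha ρ E θ₁ ≤ ((sldFisher (ρ θ₁).1 L / 2 : ℝ) : EReal) := by
  set J := sldFisher (ρ θ₁).1 L with hJ
  have hJ0 : 0 ≤ J := (trace_mul_mul_eq_sldFisher (ρ θ₁).2.1 hL.1).2.2
  have hm' : (0 : ℝ) < m := by exact_mod_cast hm
  have hunique : UniqueDiffWithinAt ℝ Θ θ₁ := by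
    rcases hΘ with h | h
    · exact (uniqueDiffWithinAt_Ioi θ₁).mono_nhds
        (le_inf nhdsWithin_le_nhds (le_principal_iff.mpr h))
    · exact (uniqueDiffWithinAt_Iio θ₁).mono_nhds
        (le_inf nhdsWithin_le_nhds (le_principal_iff.mpr h))
  -- The sign `s` selects the side of `θ₁` on which `Θ` contains an interval.
  have hpath : ∃ s : ℝ, |s| = 1 ∧ ∀ r : ℝ, 0 < r →
      Tendsto (fun ε => θ₁ + s * (r * ε)) (𝓝[>] 0) (𝓝[Θ \ {θ₁}] θ₁) := by
    have hcont : ∀ s r : ℝ, Tendsto (fun ε => θ₁ + s * (r * ε)) (𝓝[>] 0) (𝓝 θ₁) := fun s r => by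
      have h : Continuous fun ε : ℝ => θ₁ + s * (r * ε) := by fun_prop
      simpa using (h.tendsto 0).mono_left nhdsWithin_le_nhds
    rcases hΘ with h | h
    · refine ⟨1, by simp, fun r hr => ?_⟩
      have h1 : Tendsto (fun ε => θ₁ + 1 * (r * ε)) (𝓝[>] 0) (𝓝[>] θ₁) :=
        tendsto_nhdsWithin_iff.mpr ⟨hcont 1 r, eventually_mem_nhdsWithin.mono fun ε hε => by
          have := mul_pos hr (Set.mem_Ioi.mp hε)
          rw [Set.mem_Ioi]
          linarith⟩
      exact h1.mono_right (le_inf nhdsWithin_le_nhds (le_principal_iff.mpr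
        (inter_mem h (eventually_mem_nhdsWithin.mono fun x hx => (Set.mem_Ioi.mp hx).ne'))))
    · refine ⟨-1, by simp, fun r hr => ?_⟩
      have h1 : Tendsto (fun ε => θ₁ + -1 * (r * ε)) (𝓝[>] 0) (𝓝[<] θ₁) :=
        tendsto_nhdsWithin_iff.mpr ⟨hcont (-1) r, eventually_mem_nhdsWithin.mono fun ε hε => by
          have := mul_pos hr (Set.mem_Ioi.mp hε)
          rw [Set.mem_Iio]
          linarith⟩
      exact h1.mono_right (le_inf nhdsWithin_le_nhds (le_principal_iff.mpr
        (inter_mem h (eventually_mem_nhdsWithin.mono fun x hx => (Set.mem_Iio.mp hx).ne))))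
  obtain ⟨s, hs, hpath⟩ := hpath
  refine EReal.le_of_forall_lt_iff_le.mp fun c hc => ?_
  rw [EReal.coe_lt_coe_iff] at hc
  -- The slack `δ` is spent twice: on the strict inequality for the information, and on the
  -- comparison parameter at distance `(1 + δ) * ε`, which must exceed `ε`.
  obtain ⟨δ, hδc, hδ⟩ : ∃ δ : ℝ, (J + δ) / 2 * (1 + δ) ^ 2 < c ∧ 0 < δ := by
    have h1 : ContinuousAt (fun δ : ℝ => (J + δ) / 2 * (1 + δ) ^ 2) 0 := by fun_prop
    have h2 : ∀ᶠ δ in 𝓝 (0 : ℝ), (J + δ) / 2 * (1 + δ) ^ 2 < c :=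
      h1.eventually_lt continuousAt_const (by simpa using hc)
    have h3 : ∀ᶠ δ in 𝓝[>] (0 : ℝ), 0 < δ := self_mem_nhdsWithin
    exact ((h2.filter_mono nhdsWithin_le_nhds).and h3).exists
  have hdiv := eventually_maxDivergence_le.{u} (ρ := fun θ => (ρ θ).tensorPow m)
    (hsupp.mono fun θ hθ => tensorMatrix_ker_le hθ)
    (fun x y => hasDerivWithinAt_tensorMatrix hderiv x y) (isSLD_tensorSum m hL)
    (J := m * (J + δ)) (by
      refine (sldFisher_tensorSum m (ρ θ₁).2.2
        (trace_mul_eq_zero_of_isSLD hunique hderiv hL)).trans_lt ?_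
      rw [← hJ]
      exact mul_lt_mul_of_pos_left (by linarith) hm')
  refine limsup_le_of_le (h := ?_)
  filter_upwards [(hpath (1 + δ) (by linarith)).eventually hdiv,
    (hpath (1 + δ) (by linarith)).eventually eventually_mem_nhdsWithin, self_mem_nhdsWithin]
    with ε hε hmem hε0
  have hε0' : 0 < ε := hε0
  have hβ := bahadurBeta_le_of_maxDivergence_le hm hE (ε := ε) hmem.1 (by
    rw [add_sub_cancel_left, abs_mul, hs, one_mul, abs_of_pos (by positivity)]
    nlinarith) (by positivity) hε
  refine (EReal.div_le_div_right_of_nonneg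
    (EReal.coe_nonneg.mpr (sq_nonneg ε)) hβ).trans ?_
  rw [← EReal.coe_div, EReal.coe_le_coe_iff]
  refine le_of_eq_of_le ?_ hδc.le
  have hs2 : s ^ 2 = 1 := by rw [← sq_abs, hs, one_pow]
  rw [add_sub_cancel_left, mul_pow, hs2]
  field_simp

end LocalBound

end QuantumEstimation

theorem mainTheorem7 {d : Type*} [Fintype d] [DecidableEq d] {Ω : Type u} [MeasurableSpace Ω]
    (m : ℕ) (hm : 0 < m) (Θ : Set ℝ) (ρ : ℝ → State d)
    (E : (n : ℕ) → AdaptiveEstimator Ω d m n) (hE : WeaklyConsistent Θ ρ E)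
    (θ₁ : ℝ) (hθ₁ : θ₁ ∈ Θ) :
    (∀ ε : ℝ, 0 < ε →
      bahadurBeta ρ E θ₁ ε ≤ ⨅ θ ∈ Θ, ⨅ (_ : ε < |θ - θ₁|),
        ((maxDivergence.{u} ((ρ θ).tensorPow m) ((ρ θ₁).tensorPow m) / (m : ℝ≥0∞) : ℝ≥0∞) :
          EReal)) ∧
    ((Θ ∈ 𝓝[>] θ₁ ∨ Θ ∈ 𝓝[<] θ₁) →
      (∀ᶠ θ in 𝓝[Θ] θ₁, ∀ v : d → ℂ, (ρ θ₁).1 *ᵥ v = 0 → (ρ θ).1 *ᵥ v = 0) →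
      ∀ ρ' L : Matrix d d ℂ,
        (∀ i j, HasDerivWithinAt (fun θ => (ρ θ).1 i j) (ρ' i j) Θ θ₁) →
        IsSLD (ρ θ₁).1 ρ' L →
        bahadurAlpha ρ E θ₁ ≤ ((sldFisher (ρ θ₁).1 L / 2 : ℝ) : EReal)) := by
  refine ⟨fun ε _ => le_iInf₂ fun θ hθ => le_iInf fun hlt =>
    bahadurBeta_le_maxDivergence_div hm hE hθ hlt, fun hΘ hsupp ρ' L hderiv hL =>
    bahadurAlpha_le_sldFisher_div_two hm hE hΘ hsupp hderiv hL⟩
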